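/- Let $A$ be a unital $C^*$-algebra and let $S\subseteq A$ be an operator system generating $A$, i.e. a self-adjoint linear subspace containing $\mathbf 1$ such that $A=C^*(S)$ is the smallest closed $*$-subalgebra of $A$ containing $S$. Let $H$ be a Hilbert space and let $\phi:S\to\mathcal B(H)$ be a unital completely positive (UCP) map. Then the following are equivalent. (1) $\phi$ has the unique extension property: $\phi$ has a unique completely positive extension $\tilde\phi:C^*(S)\to\mathcal B(H)$, and $\tilde\phi$ is a representation (a unital $*$-homomorphism). (2) $\phi$ is maximal: for every Hilbert space $K\supseteq H$ and every UCP map $\phi':S\to\mathcal B(K)$ that dilates $\phi$, i.e. $P_H\phi'(x)\restriction_H=\phi(x)$ for all $x\in S$, there is a UCP map $\psi:S\to\mathcal B(K\ominus H)$ such that $\phi'=\phi\oplus\psi$ with respect to the decomposition $K=H\oplus(K\ominus H)$. -/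

import Mathlib

open scoped CStarAlgebra

universe u v w

/-- An operator system generating the unital C⋆-algebra `A`: a self-adjoint linear subspace `S`
of `A` (not necessarily closed) that contains the unit, such that the smallest closed
star-subalgebra of `A` containing `S` is `A` itself; thus `A` is `C⋆(S)`. -/
structure OperatorSystem (A : Type*) [CStarAlgebra A] extends Submodule ℂ A where
  star_mem : ∀ x ∈ toSubmodule, star x ∈ toSubmodule
  one_mem : (1 : A) ∈ toSubmodule
  generates : (StarAlgebra.adjoin ℂ (toSubmodule : Set A)).topologicalClosure = ⊤

/-- Unital completely positive maps `S → B(H)` on an operator system. A matrix over `S` is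
positive if it is positive in the C⋆-algebra of matrices over the ambient C⋆-algebra `A`. -/
structure UCPMap {A : Type*} [CStarAlgebra A] [PartialOrder A] [StarOrderedRing A]
    (S : OperatorSystem A) (H : Type*) [NormedAddCommGroup H] [InnerProductSpace ℂ H]
    [CompleteSpace H] extends S.toSubmodule →ₗ[ℂ] (H →L[ℂ] H) where
  map_matrix_nonneg : ∀ (k : ℕ) (M : Matrix (Fin k) (Fin k) S.toSubmodule),
    0 ≤ CStarMatrix.ofMatrix (M.map (fun x => (x : A))) →
      0 ≤ CStarMatrix.ofMatrix (M.map (fun x => toLinearMap x))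
  map_one : toLinearMap ⟨1, S.one_mem⟩ = 1

namespace UCPMap

noncomputable instance {A : Type*} [CStarAlgebra A] [PartialOrder A] [StarOrderedRing A]
    {S : OperatorSystem A} {H : Type*} [NormedAddCommGroup H] [InnerProductSpace ℂ H]
    [CompleteSpace H] : CoeFun (UCPMap S H) (fun _ => S.toSubmodule → (H →L[ℂ] H)) where
  coe φ := φ.toLinearMap

/-- `Φ : A → B(H)` extends `φ : S → B(H)`. -/
def IsExtension {A : Type*} [CStarAlgebra A] [PartialOrder A] [StarOrderedRing A]
    {S : OperatorSystem A} {H : Type*} [NormedAddCommGroup H] [InnerProductSpace ℂ H]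
    [CompleteSpace H] (φ : UCPMap S H) (Φ : A →CP (H →L[ℂ] H)) : Prop :=
  ∀ x : S.toSubmodule, Φ (x : A) = φ x

/-- The unique extension property: `φ` has exactly one completely positive extension to
`A = C⋆(S)`, and this extension is a representation (a unital star-homomorphism into `B(H)`). -/
def HasUniqueExtensionProperty {A : Type*} [CStarAlgebra A] [PartialOrder A] [StarOrderedRing A]
    {S : OperatorSystem A} {H : Type*} [NormedAddCommGroup H] [InnerProductSpace ℂ H]
    [CompleteSpace H] (φ : UCPMap S H) : Prop :=
  ∃ Φ : A →CP (H →L[ℂ] H), φ.IsExtension Φ ∧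
    (∀ Ψ : A →CP (H →L[ℂ] H), φ.IsExtension Ψ → Ψ = Φ) ∧
    ∃ π : A →⋆ₐ[ℂ] (H →L[ℂ] H), ∀ a : A, π a = Φ a

/-- `φ'` on `K` is a dilation of `φ` on `H`, where `H` is regarded as a subspace of `K` through
the linear isometry `V`: the compression `V⋆ φ'(x) V` is `φ(x)` for all `x` in `S`. -/
def IsDilation {A : Type*} [CStarAlgebra A] [PartialOrder A] [StarOrderedRing A]
    {S : OperatorSystem A} {H : Type*} [NormedAddCommGroup H] [InnerProductSpace ℂ H]
    [CompleteSpace H] {K : Type*} [NormedAddCommGroup K] [InnerProductSpace ℂ K]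
    [CompleteSpace K] (φ : UCPMap S H) (V : H →ₗᵢ[ℂ] K) (φ' : UCPMap S K) : Prop :=
  ∀ x : S.toSubmodule,
    ContinuousLinearMap.adjoint V.toContinuousLinearMap ∘L φ' x ∘L V.toContinuousLinearMap = φ x

/-- With respect to the decomposition `K = V(H) ⊕ V(H)ᗮ`, the map `φ'` is the direct sum of
`φ` and `ψ`. -/
def IsDirectSum {A : Type*} [CStarAlgebra A] [PartialOrder A] [StarOrderedRing A]
    {S : OperatorSystem A} {H : Type*} [NormedAddCommGroup H] [InnerProductSpace ℂ H]
    [CompleteSpace H] {K : Type*} [NormedAddCommGroup K] [InnerProductSpace ℂ K]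
    [CompleteSpace K] (V : H →ₗᵢ[ℂ] K) (φ' : UCPMap S K) (φ : UCPMap S H)
    (ψ : UCPMap S ((LinearMap.range V.toLinearMap)ᗮ : Submodule ℂ K)) : Prop :=
  ∀ (x : S.toSubmodule) (h : H) (k : ((LinearMap.range V.toLinearMap)ᗮ : Submodule ℂ K)),
    φ' x (V h + (k : K)) = V (φ x h) + (ψ x k : K)

/-- `φ` is maximal: every dilation `φ'` of `φ` (on a Hilbert space in the universe `w`) is
trivial, that is, `φ' = φ ⊕ ψ` for some UCP map `ψ`. -/
def IsMaximal {A : Type u} [CStarAlgebra A] [PartialOrder A] [StarOrderedRing A]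
    {S : OperatorSystem A} {H : Type v} [NormedAddCommGroup H] [InnerProductSpace ℂ H]
    [CompleteSpace H] (φ : UCPMap S H) : Prop :=
  ∀ (K : Type w) [NormedAddCommGroup K] [InnerProductSpace ℂ K] [CompleteSpace K]
    (V : H →ₗᵢ[ℂ] K) (φ' : UCPMap S K), φ.IsDilation V φ' →
      ∃ ψ : UCPMap S ((LinearMap.range V.toLinearMap)ᗮ : Submodule ℂ K), IsDirectSum V φ' φ ψ

end UCPMap

/-!
Every unital completely positive map `φ` on `S` is the compression of a representation of `A`: the
functional `x ↦ ∑ ⟪b i, φ (x i j) (b j)⟫` on finitely supported matrices over `S` extends, by the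
Riesz extension theorem, to a functional on matrices over `A` with positive real part on accretive
matrices (Arveson), and the GNS construction for the extension yields the representation
(Stinespring).

Given a dilation `φ'` of a map `φ` with the unique extension property, let a representation `π`
dilate `φ'`. The compression of `π` to `H` extends `φ`, so it is multiplicative, which forces `H` to
be invariant under `π`; hence `H` is invariant under `φ'`, and by self-adjointness so is its
complement. Conversely, if `φ` is maximal, let `π` dilate any completely positive extension of `φ`.
Then `H` is invariant under `π(S)`, hence under `π(A)`, so the extension is a representation, and
representations of `A` are determined by their values on `S`.
-/

open scoped ComplexOrder InnerProductSpace Matrix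

open ContinuousLinearMap (adjoint)

section NonUnitalCStarAlgebra

variable {B : Type*} [NonUnitalCStarAlgebra B] [PartialOrder B] [StarOrderedRing B] {b : B}

lemma exists_eq_star_mul_self_of_nonneg (hb : 0 ≤ b) : ∃ c, b = star c * c :=
  CStarAlgebra.nonneg_iff_eq_star_mul_self.1 hb

/- If `q` is the negative part of `b`, then `q * b * q = -q ^ 3`. -/
lemma nonneg_of_star_mul_mul_eq_neg (hb : IsSelfAdjoint b)
    (h : ∀ q r, star q * b * q = -(star r * r) → r = 0) : 0 ≤ b := by
  have hq : star b⁻ = b⁻ := (CFC.negPart_nonneg b).isSelfAdjoint.star_eq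
  obtain ⟨r, hr⟩ := exists_eq_star_mul_self_of_nonneg (CFC.negPart_nonneg b)
  have hqbq : star b⁻ * b * b⁻ = -(star (r * b⁻) * (r * b⁻)) := by
    calc star b⁻ * b * b⁻ = b⁻ * (b⁺ - b⁻) * b⁻ := by rw [hq, CFC.posPart_sub_negPart b hb]
      _ = -(b⁻ * b⁻ * b⁻) := by rw [mul_sub, CFC.negPart_mul_posPart, zero_sub, neg_mul]
      _ = -(star b⁻ * (star r * r) * b⁻) := by rw [← hr, hq]
      _ = -(star (r * b⁻) * (r * b⁻)) := by simp only [star_mul, mul_assoc]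
  have hsq : star b⁻ * b⁻ = 0 := by
    calc star b⁻ * b⁻ = star r * r * b⁻ := by rw [← hr, hq]
      _ = 0 := by rw [mul_assoc, h _ _ hqbq, mul_zero]
  rw [← CFC.posPart_sub_negPart b hb, (CStarRing.star_mul_self_eq_zero_iff _).1 hsq, sub_zero]
  exact CFC.posPart_nonneg b

end NonUnitalCStarAlgebra

section PosSemidef

variable {A : Type*} [CStarAlgebra A] [PartialOrder A] [StarOrderedRing A] {n : Type*}

lemma trace_conjTranspose_mul_self_eq_zero_iff {m : Type*} [Fintype m] [Fintype n]
    {M : Matrix m n A} : (Mᴴ * M).trace = 0 ↔ M = 0 := by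
  simp only [Matrix.trace, Matrix.diag_apply, Matrix.mul_apply, Matrix.conjTranspose_apply]
  rw [Finset.sum_eq_zero_iff_of_nonneg fun i _ ↦ Finset.sum_nonneg fun k _ ↦
    star_mul_self_nonneg (M k i)]
  simp only [Finset.sum_eq_zero_iff_of_nonneg fun _ _ ↦ star_mul_self_nonneg (M _ _),
    Finset.mem_univ, true_imp_iff, CStarRing.star_mul_self_eq_zero_iff]
  exact ⟨fun h ↦ Matrix.ext fun k i ↦ h i k, by simp +contextual⟩

theorem ofMatrix_nonneg_iff_posSemidef [Fintype n] {M : Matrix n n A} :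
    0 ≤ CStarMatrix.ofMatrix M ↔ M.PosSemidef := by
  refine ⟨fun h ↦ ?_, fun h ↦ nonneg_of_star_mul_mul_eq_neg h.isHermitian fun Q R hQR ↦ ?_⟩
  · obtain ⟨N, hN : M = (CStarMatrix.ofMatrix.symm N)ᴴ * CStarMatrix.ofMatrix.symm N⟩ :=
      exists_eq_star_mul_self_of_nonneg h
    exact hN ▸ Matrix.posSemidef_conjTranspose_mul_self _
  · let R' : Matrix n n A := CStarMatrix.ofMatrix.symm R
    have hneg : (-(R'ᴴ * R')).PosSemidef :=
      hQR ▸ h.conjTranspose_mul_mul_same (CStarMatrix.ofMatrix.symm Q)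
    have htrace : 0 ≤ -(R'ᴴ * R').trace := Matrix.trace_neg (R'ᴴ * R') ▸ hneg.trace_nonneg
    exact trace_conjTranspose_mul_self_eq_zero_iff.1 <|
      (neg_nonneg.1 htrace).antisymm (Matrix.posSemidef_conjTranspose_mul_self R').trace_nonneg

lemma posSemidef_vecMulVec_star (f : n → A) : (Matrix.vecMulVec (star f) f).PosSemidef := by
  refine ⟨by simp [Matrix.IsHermitian, Matrix.conjTranspose_vecMulVec], fun x ↦ ?_⟩
  convert star_mul_self_nonneg (x.sum fun i a ↦ f i * a) using 1
  simp only [Matrix.vecMulVec_apply, Pi.star_apply, Finsupp.sum, star_sum, star_mul,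
    Finset.sum_mul_sum, mul_assoc]

lemma posSemidef_single [DecidableEq n] (i : n) {a : A} (ha : 0 ≤ a) :
    (Matrix.single i i a).PosSemidef := by
  rw [← Matrix.diagonal_single]
  exact .diagonal (Pi.single_nonneg.2 ha)

lemma vecMulVec_single_single {R : Type*} [MulZeroClass R] [DecidableEq n] (i j : n) (a b : R) :
    Matrix.vecMulVec (Pi.single i a) (Pi.single j b) = Matrix.single i j (a * b) := by
  ext k l
  by_cases hk : i = k <;> by_cases hl : j = l <;>
    simp [Matrix.vecMulVec_apply, hk, hl]

lemma posSemidef_single_add_single [DecidableEq n] (i j : n) (a : A) :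
    (Matrix.single i i 1 + Matrix.single i j a + Matrix.single j i (star a) +
      Matrix.single j j (algebraMap ℝ A ‖star a * a‖)).PosSemidef := by
  have hsq := posSemidef_vecMulVec_star (Pi.single (M := fun _ ↦ A) i 1 + Pi.single j a)
  have hdiff := posSemidef_single j
    (sub_nonneg.2 (IsSelfAdjoint.star_mul_self a).le_algebraMap_norm_self)
  have hsplit : Matrix.single j j (algebraMap ℝ A ‖star a * a‖) =
      Matrix.single j j (star a * a) +
        Matrix.single j j (algebraMap ℝ A ‖star a * a‖ - star a * a) := by
    rw [← Matrix.single_add, add_sub_cancel]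
  rw [hsplit, ← add_assoc]
  convert hsq.add hdiff using 2
  rw [star_add, ← Pi.single_star, ← Pi.single_star]
  simp only [Matrix.vecMulVec_add, Matrix.add_vecMulVec, vecMulVec_single_single, star_one,
    one_mul, mul_one]
  abel

end PosSemidef

section Operators

variable {H : Type*} [NormedAddCommGroup H] [InnerProductSpace ℂ H]
  {K : Type*} [NormedAddCommGroup K] [InnerProductSpace ℂ K] {n : Type*}

lemma nonneg_iff_forall_inner_nonneg {T : H →L[ℂ] H} : 0 ≤ T ↔ ∀ x, 0 ≤ ⟪x, T x⟫_ℂ := by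
  rw [ContinuousLinearMap.nonneg_iff_isPositive]
  refine ⟨fun h ↦ h.inner_nonneg_right, fun h ↦ (T.isPositive_iff_complex).2 fun x ↦ ?_⟩
  rw [← inner_conj_symm, Complex.conj_eq_iff_real.2 ⟨_, Complex.eq_re_of_ofReal_le (h x)⟩]
  exact ⟨(Complex.eq_re_of_ofReal_le (h x)).symm, (Complex.le_def.1 (h x)).1⟩

variable [CompleteSpace H] [CompleteSpace K]

lemma posSemidef_iff_forall_sum_inner_nonneg [Fintype n] {M : Matrix n n (H →L[ℂ] H)} :
    M.PosSemidef ↔ M.IsHermitian ∧ ∀ h : n → H, 0 ≤ ∑ i, ∑ j, ⟪h i, M i j (h j)⟫_ℂ := by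
  rw [Matrix.posSemidef_iff_dotProduct_mulVec]
  refine and_congr_right fun _ ↦ ?_
  have hinner (x : n → H →L[ℂ] H) (ξ : H) : ⟪ξ, (star x ⬝ᵥ M *ᵥ x) ξ⟫_ℂ =
      ∑ i, ∑ j, ⟪x i ξ, M i j (x j ξ)⟫_ℂ := by
    simp [dotProduct, Matrix.mulVec, ContinuousLinearMap.star_eq_adjoint,
      ContinuousLinearMap.adjoint_inner_right]
  simp only [nonneg_iff_forall_inner_nonneg, hinner]
  refine ⟨fun hM h ↦ ?_, fun hM x ξ ↦ hM fun i ↦ x i ξ⟩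
  rcases subsingleton_or_nontrivial H with _ | _
  · simp [Subsingleton.elim (h _) 0]
  · obtain ⟨ξ, hξ⟩ := exists_norm_eq H zero_le_one
    simpa [hξ] using hM (fun i ↦ InnerProductSpace.rankOne ℂ (h i) ξ) ξ

/-- The compression `T ↦ V⋆ T V` of operators on `K` along `V : H → K`. -/
noncomputable def compress (V : H →L[ℂ] K) : (K →L[ℂ] K) →ₗ[ℂ] (H →L[ℂ] H) where
  toFun T := adjoint V ∘L T ∘L V
  map_add' := by simp
  map_smul' := by simp

lemma compress_apply (V : H →L[ℂ] K) (T : K →L[ℂ] K) :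
    compress V T = adjoint V ∘L T ∘L V := rfl

lemma inner_compress_apply (V : H →L[ℂ] K) (T : K →L[ℂ] K) (h k : H) :
    ⟪h, compress V T k⟫_ℂ = ⟪V h, T (V k)⟫_ℂ :=
  ContinuousLinearMap.adjoint_inner_right V h (T (V k))

lemma compress_eq_iff {V : H →L[ℂ] K} {T : K →L[ℂ] K} {R : H →L[ℂ] H} :
    compress V T = R ↔ ∀ h k, ⟪V h, T (V k)⟫_ℂ = ⟪h, R k⟫_ℂ := by
  simp only [← inner_compress_apply]
  exact ⟨fun h _ _ ↦ h ▸ rfl, fun h ↦ ContinuousLinearMap.ext fun k ↦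
    ext_inner_left ℂ fun g ↦ h g k⟩

lemma star_compress (V : H →L[ℂ] K) (T : K →L[ℂ] K) :
    star (compress V T) = compress V (star T) := by
  simp [compress_apply, ContinuousLinearMap.star_eq_adjoint, ContinuousLinearMap.comp_assoc]

lemma compress_one (V : H →ₗᵢ[ℂ] K) : compress V.toContinuousLinearMap 1 = 1 :=
  compress_eq_iff.2 V.inner_map_map

lemma posSemidef_map_compress [Finite n] {M : Matrix n n (K →L[ℂ] K)} (hM : M.PosSemidef)
    (V : H →L[ℂ] K) : (M.map (compress V)).PosSemidef := by
  cases nonempty_fintype n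
  rw [posSemidef_iff_forall_sum_inner_nonneg] at hM ⊢
  refine ⟨hM.1.map _ fun T ↦ (star_compress V T).symm, fun h ↦ ?_⟩
  simpa only [Matrix.map_apply, inner_compress_apply] using hM.2 fun i ↦ V (h i)

lemma ofMatrix_map_compress_nonneg [Fintype n] {M : Matrix n n (K →L[ℂ] K)}
    (hM : 0 ≤ CStarMatrix.ofMatrix M) (V : H →L[ℂ] K) :
    0 ≤ CStarMatrix.ofMatrix (M.map (compress V)) := by
  rw [ofMatrix_nonneg_iff_posSemidef] at hM ⊢
  exact posSemidef_map_compress hM V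

end Operators

section

variable {A : Type*} [CStarAlgebra A] [PartialOrder A] [StarOrderedRing A]
  {H : Type*} [NormedAddCommGroup H] [InnerProductSpace ℂ H] [CompleteSpace H]
  {K : Type*} [NormedAddCommGroup K] [InnerProductSpace ℂ K] [CompleteSpace K]

/-- The compression `a ↦ V⋆ Φ(a) V` of a completely positive map along `V : H → K`. -/
noncomputable def compressCP (Φ : A →CP (K →L[ℂ] K)) (V : H →L[ℂ] K) : A →CP (H →L[ℂ] H) where
  toLinearMap := compress V ∘ₗ Φ.toLinearMap
  map_cstarMatrix_nonneg' k _ hM :=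
    ofMatrix_map_compress_nonneg (Φ.map_cstarMatrix_nonneg' k _ hM) V

lemma compressCP_apply (Φ : A →CP (K →L[ℂ] K)) (V : H →L[ℂ] K) (a : A) :
    compressCP Φ V a = compress V (Φ a) := rfl

end

namespace OperatorSystem

variable {A : Type*} [CStarAlgebra A] (S : OperatorSystem A)

instance : One S.toSubmodule := ⟨⟨1, S.one_mem⟩⟩

instance : Star S.toSubmodule := ⟨fun x ↦ ⟨star (x : A), S.star_mem x x.2⟩⟩

@[simp, norm_cast]
lemma coe_one : ((1 : S.toSubmodule) : A) = 1 := rfl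

@[simp, norm_cast]
lemma coe_star (x : S.toSubmodule) : ((star x : S.toSubmodule) : A) = star (x : A) := rfl

lemma eq_top_of_isClosed {T : StarSubalgebra ℂ A} (hT : IsClosed (T : Set A))
    (hS : (S.toSubmodule : Set A) ⊆ T) : T = ⊤ := by
  rw [eq_top_iff, ← S.generates]
  exact StarSubalgebra.topologicalClosure_minimal (StarAlgebra.adjoin_le hS) hT

lemma starAlgHom_ext {B : Type*} [CStarAlgebra B] {π ρ : A →⋆ₐ[ℂ] B}
    (h : Set.EqOn π ρ S.toSubmodule) : π = ρ := by
  have htop := S.eq_top_of_isClosed (T := StarAlgHom.equalizer π ρ)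
    (isClosed_eq (map_continuous π) (map_continuous ρ)) h
  exact StarAlgHom.ext fun a ↦ htop.ge (StarSubalgebra.mem_top (x := a))

/-- The whole C⋆-algebra as an operator system. -/
noncomputable def top (A : Type*) [CStarAlgebra A] : OperatorSystem A where
  toSubmodule := ⊤
  star_mem _ _ := trivial
  one_mem := trivial
  generates := by
    rw [← top_le_iff]
    exact fun a _ ↦ StarSubalgebra.le_topologicalClosure _ (StarAlgebra.subset_adjoin ℂ _ trivial)

end OperatorSystem

namespace UCPMap

variable {A : Type*} [CStarAlgebra A] [PartialOrder A] [StarOrderedRing A] {S : OperatorSystem A}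
  {H : Type*} [NormedAddCommGroup H] [InnerProductSpace ℂ H] [CompleteSpace H]
  {K : Type*} [NormedAddCommGroup K] [InnerProductSpace ℂ K] [CompleteSpace K]

lemma apply_one (φ : UCPMap S H) : φ 1 = 1 := φ.map_one

lemma map_posSemidef {n : Type*} [Finite n] (φ : UCPMap S H) {M : Matrix n n S.toSubmodule}
    (hM : (M.map fun x ↦ (x : A)).PosSemidef) : (M.map φ.toLinearMap).PosSemidef := by
  let e := (Finite.equivFin n).symm
  rw [← Matrix.posSemidef_submatrix_equiv e, ← ofMatrix_nonneg_iff_posSemidef] at hM ⊢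
  exact φ.map_matrix_nonneg _ (M.submatrix e e) hM

lemma map_star (φ : UCPMap S H) (x : S.toSubmodule) : φ (star x) = star (φ x) := by
  let M : Matrix (Fin 2) (Fin 2) S.toSubmodule :=
    !![1, x; star x, (‖star (x : A) * x‖ : ℂ) • 1]
  have hM : (M.map fun x ↦ (x : A)).PosSemidef := by
    convert posSemidef_single_add_single (0 : Fin 2) 1 (x : A) using 1
    ext i j
    fin_cases i <;> fin_cases j <;> simp [M, Algebra.algebraMap_eq_smul_one]
  exact ((φ.map_posSemidef hM).isHermitian.apply 1 0).symm

/-- The compression `x ↦ V⋆ φ(x) V` of a unital completely positive map by an isometry. -/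
noncomputable def compression (φ : UCPMap S K) (V : H →ₗᵢ[ℂ] K) : UCPMap S H where
  toLinearMap := compress V.toContinuousLinearMap ∘ₗ φ.toLinearMap
  map_matrix_nonneg k M hM :=
    ofMatrix_map_compress_nonneg (φ.map_matrix_nonneg k M hM) V.toContinuousLinearMap
  map_one := (congrArg _ φ.map_one).trans (compress_one V)

/-- The restriction of a unital completely positive map on `A` to the operator system `S`. -/
noncomputable def ofCompletelyPositiveMap (Φ : A →CP (H →L[ℂ] H)) (h1 : Φ 1 = 1) :
    UCPMap S H where
  toLinearMap := Φ.toLinearMap ∘ₗ S.toSubmodule.subtype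
  map_matrix_nonneg k _ hM := Φ.map_cstarMatrix_nonneg' k _ hM
  map_one := h1

/-- The restriction of a representation of `A` to the operator system `S`. -/
noncomputable def ofStarAlgHom (π : A →⋆ₐ[ℂ] (H →L[ℂ] H)) : UCPMap S H :=
  ofCompletelyPositiveMap (π : A →CP (H →L[ℂ] H)) (_root_.map_one π)

@[simp]
lemma ofStarAlgHom_apply (π : A →⋆ₐ[ℂ] (H →L[ℂ] H)) (x : S.toSubmodule) :
    (ofStarAlgHom π : UCPMap S H) x = π x := rfl

lemma isDilation_iff {φ : UCPMap S H} {V : H →ₗᵢ[ℂ] K} {φ' : UCPMap S K} :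
    φ.IsDilation V φ' ↔ ∀ x h k, ⟪V h, φ' x (V k)⟫_ℂ = ⟪h, φ x k⟫_ℂ :=
  forall_congr' fun _ ↦ compress_eq_iff (V := V.toContinuousLinearMap)

end UCPMap

theorem exists_linearMap_extension_re_nonneg {𝕜 D E : Type*} [RCLike 𝕜] [AddCommGroup D]
    [Module 𝕜 D] [AddCommGroup E] [Module ℝ E] [Module 𝕜 E] [IsScalarTower ℝ 𝕜 E]
    (s : PointedCone ℝ E) {j : D →ₗ[𝕜] E} (hj : Function.Injective j) (F : D →ₗ[𝕜] 𝕜)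
    (hF : ∀ x, j x ∈ s → 0 ≤ RCLike.re (F x)) (hs : ∀ y, ∃ x, j x + y ∈ s) :
    ∃ G : E →ₗ[𝕜] 𝕜, (∀ x, G (j x) = F x) ∧ ∀ y ∈ s, 0 ≤ RCLike.re (G y) := by
  let F' : LinearMap.range j →ₗ[𝕜] 𝕜 := F ∘ₗ (LinearEquiv.ofInjective j hj).symm.toLinearMap
  have hF' (x : D) : F' ⟨j x, x, rfl⟩ = F x :=
    congrArg F ((LinearEquiv.ofInjective j hj).symm_apply_apply x)
  obtain ⟨g, hgF, hg⟩ := riesz_extension s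
    ⟨(LinearMap.range j).restrictScalars ℝ, RCLike.reLm ∘ₗ F'.restrictScalars ℝ⟩
    (by rintro ⟨_, x, rfl⟩ hx; exact (hF x hx).trans_eq (congrArg _ (hF' x).symm))
    (fun y ↦ (hs y).imp' (fun x ↦ ⟨j x, x, rfl⟩) fun _ ↦ id)
  have hgj (x : D) : g (j x) = RCLike.re (F x) :=
    (hgF ⟨j x, x, rfl⟩).trans (congrArg RCLike.re (hF' x))
  refine ⟨Module.Dual.extendRCLike g, fun x ↦ ?_, fun y hy ↦ ?_⟩
  · apply RCLike.ext
    · rw [Module.Dual.re_extendRCLike_apply, hgj]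
    · rw [Module.Dual.im_extendRCLike_apply, ← map_smul, hgj, map_smul]
      simp
  · simpa using hg y hy

section FinsuppMatrix

section

variable {ι R : Type*} [AddCommMonoid R] [Module ℂ R]

/-- A finitely supported family indexed by `ι × ι`, viewed as a matrix. -/
def finsuppMatrix : (ι × ι →₀ R) →ₗ[ℂ] Matrix ι ι R where
  toFun x := Matrix.of fun i j ↦ x (i, j)
  map_add' _ _ := rfl
  map_smul' _ _ := rfl

@[simp]
lemma finsuppMatrix_apply (x : ι × ι →₀ R) (i j : ι) : finsuppMatrix x i j = x (i, j) := rfl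

lemma finsuppMatrix_single [DecidableEq ι] (i j : ι) (a : R) :
    finsuppMatrix (Finsupp.single (i, j) a) = Matrix.single i j a := by
  ext k l
  simp [Finsupp.single_apply, Matrix.single_apply]

end

section

variable {ι R : Type*} [Semiring R] [StarRing R]

/-- The finitely supported rank-one matrix `(i, j) ↦ star (f i) * g j`. -/
noncomputable def finsuppStarMul (f g : ι →₀ R) : ι × ι →₀ R :=
  Finsupp.onFinset (f.support ×ˢ g.support) (fun p ↦ star (f p.1) * g p.2) fun p hp ↦ by
    simp only [Finset.mem_product, Finsupp.mem_support_iff]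
    exact ⟨fun h ↦ hp (by simp [h]), fun h ↦ hp (by simp [h])⟩

@[simp]
lemma finsuppStarMul_apply (f g : ι →₀ R) (p : ι × ι) :
    finsuppStarMul f g p = star (f p.1) * g p.2 := rfl

lemma finsuppMatrix_finsuppStarMul [Module ℂ R] (f g : ι →₀ R) :
    finsuppMatrix (finsuppStarMul f g) = Matrix.vecMulVec (star f) g := rfl

lemma finsuppStarMul_single_single (i j : ι) (a b : R) :
    finsuppStarMul (.single i a) (.single j b) = .single (i, j) (star a * b) := by
  classical
  ext ⟨k, l⟩
  by_cases hi : i = k <;> by_cases hj : j = l <;> simp [hi, hj]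

lemma finsuppStarMul_star_smul (a : R) (f g : ι →₀ R) :
    finsuppStarMul (star a • f) g = finsuppStarMul f (a • g) := by
  ext
  simp [mul_assoc]

end

variable {ι A : Type*} [CStarAlgebra A] [PartialOrder A] [StarOrderedRing A]

variable (ι A) in
/-- The finitely supported matrices over `A` with positive real part. -/
noncomputable def accretiveCone : PointedCone ℝ (ι × ι →₀ A) where
  carrier := {x | (finsuppMatrix x + (finsuppMatrix x)ᴴ).PosSemidef}
  zero_mem' := by simpa using Matrix.PosSemidef.zero
  add_mem' {x y} hx hy := by
    simpa only [Set.mem_ofPred_eq, map_add, Matrix.conjTranspose_add, add_add_add_comm]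
      using Matrix.PosSemidef.add hx hy
  smul_mem' r x hx := by
    have hr : finsuppMatrix (r • x) = (r : ℝ) • finsuppMatrix x := rfl
    simpa only [Set.mem_ofPred_eq, hr, Matrix.conjTranspose_smul, star_trivial, ← smul_add]
      using Matrix.PosSemidef.smul hx r.2

lemma mem_accretiveCone {x : ι × ι →₀ A} :
    x ∈ accretiveCone ι A ↔ (finsuppMatrix x + (finsuppMatrix x)ᴴ).PosSemidef := Iff.rfl

lemma finsuppStarMul_self_mem_accretiveCone (f : ι →₀ A) :
    finsuppStarMul f f ∈ accretiveCone ι A := by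
  rw [mem_accretiveCone, finsuppMatrix_finsuppStarMul, Matrix.conjTranspose_vecMulVec, star_star]
  exact (posSemidef_vecMulVec_star f).add (posSemidef_vecMulVec_star f)

lemma mem_accretiveCone_of_add_conjTranspose_eq_zero {x : ι × ι →₀ A}
    (hx : finsuppMatrix x + (finsuppMatrix x)ᴴ = 0) : x ∈ accretiveCone ι A :=
  mem_accretiveCone.2 (hx ▸ .zero)

lemma apply_eq_conj_of_accretiveCone_nonneg {G : (ι × ι →₀ A) →ₗ[ℂ] ℂ}
    (hG : ∀ x ∈ accretiveCone ι A, 0 ≤ (G x).re) {x y : ι × ι →₀ A}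
    (hxy : finsuppMatrix y = (finsuppMatrix x)ᴴ) : G y = starRingEnd ℂ (G x) := by
  have hskew {z : ι × ι →₀ A} (hz : finsuppMatrix z + (finsuppMatrix z)ᴴ = 0) : (G z).re = 0 := by
    refine le_antisymm ?_ (hG z (mem_accretiveCone_of_add_conjTranspose_eq_zero hz))
    have hneg := hG (-z) (mem_accretiveCone_of_add_conjTranspose_eq_zero (by
      rw [map_neg, Matrix.conjTranspose_neg, ← neg_add, hz, neg_zero]))
    simpa using hneg
  have hre : (G (y - x)).re = 0 := hskew (by simp [hxy])
  have him : (G (Complex.I • (y + x))).re = 0 := hskew (by simp [hxy])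
  apply Complex.ext
  · simpa [sub_eq_zero] using hre
  · simpa [add_eq_zero_iff_eq_neg, neg_eq_iff_eq_neg] using him

/-- The (possibly degenerate) inner product `⟪f, g⟫ = G (star f ⊗ g)` on finitely supported
families in `A` induced by a positive functional `G` on matrices, as in the GNS and Stinespring
constructions. -/
noncomputable abbrev accretiveCore (G : (ι × ι →₀ A) →ₗ[ℂ] ℂ)
    (hG : ∀ x ∈ accretiveCone ι A, 0 ≤ (G x).re) : PreInnerProductSpace.Core ℂ (ι →₀ A) where
  inner f g := G (finsuppStarMul f g)
  conj_inner_symm f g := (apply_eq_conj_of_accretiveCone_nonneg hG (by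
    rw [finsuppMatrix_finsuppStarMul, finsuppMatrix_finsuppStarMul,
      Matrix.conjTranspose_vecMulVec, star_star])).symm
  re_inner_nonneg f := hG _ (finsuppStarMul_self_mem_accretiveCone f)
  add_left f g h := by
    rw [← map_add]
    exact congrArg G (by ext; simp [add_mul])
  smul_left f g r := by
    rw [← smul_eq_mul, ← map_smul]
    exact congrArg G (by ext; simp)

lemma exists_mapRange_add_mem_accretiveCone (S : OperatorSystem A) (y : ι × ι →₀ A) :
    ∃ x : ι × ι →₀ S.toSubmodule,
      Finsupp.mapRange.linearMap S.toSubmodule.subtype x + y ∈ accretiveCone ι A := by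
  classical
  induction y using Finsupp.induction_linear with
  | zero => exact ⟨0, by simp⟩
  | add y₁ y₂ h₁ h₂ =>
    obtain ⟨x₁, hx₁⟩ := h₁
    obtain ⟨x₂, hx₂⟩ := h₂
    exact ⟨x₁ + x₂, by simpa only [map_add, add_add_add_comm] using add_mem hx₁ hx₂⟩
  | single p a =>
    obtain ⟨i, j⟩ := p
    refine ⟨.single (i, i) 1 + .single (j, j) ((‖star a * a‖ : ℂ) • 1), ?_⟩
    have hdiag := (posSemidef_single i (zero_le_one' A)).add (posSemidef_single j
      (algebraMap_nonneg A (norm_nonneg (star a * a))))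
    rw [mem_accretiveCone]
    convert (posSemidef_single_add_single i j a).add hdiag using 1
    simp only [map_add, Finsupp.mapRange.linearMap_apply, Finsupp.mapRange_single,
      finsuppMatrix_single]
    simp only [Submodule.subtype_apply, OperatorSystem.coe_one, Complex.coe_smul,
      LinearMap.map_smul_of_tower, Matrix.conjTranspose_add, Matrix.conjTranspose_single,
      star_one, star_smul, star_trivial, Algebra.algebraMap_eq_smul_one]
    abel

end FinsuppMatrix

namespace UCPMap

variable {A : Type*} [CStarAlgebra A] [PartialOrder A] [StarOrderedRing A] {S : OperatorSystem A}
  {H : Type*} [NormedAddCommGroup H] [InnerProductSpace ℂ H] [CompleteSpace H] {ι n : Type*}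

lemma re_sum_inner_nonneg [Fintype n] (φ : UCPMap S H) (b : n → H) {M : Matrix n n S.toSubmodule}
    (hM : (M.map ((↑) : _ → A) + (M.map ((↑) : _ → A))ᴴ).PosSemidef) :
    0 ≤ (∑ i, ∑ j, ⟪b i, φ (M i j) (b j)⟫_ℂ).re := by
  have hφM : ((M + Matrix.of fun i j ↦ star (M j i)).map φ.toLinearMap).PosSemidef :=
    φ.map_posSemidef hM
  have hsum := (posSemidef_iff_forall_sum_inner_nonneg.1 hφM).2 b
  have hconj : ∑ i, ∑ j, ⟪b i, φ (star (M j i)) (b j)⟫_ℂ =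
      starRingEnd ℂ (∑ i, ∑ j, ⟪b i, φ (M i j) (b j)⟫_ℂ) := by
    rw [Finset.sum_comm]
    simp [map_star, ContinuousLinearMap.star_eq_adjoint, ContinuousLinearMap.adjoint_inner_right]
  simp only [Matrix.map_apply, Matrix.add_apply, Matrix.of_apply, map_add, _root_.add_apply,
    inner_add_right, Finset.sum_add_distrib, hconj, Complex.add_conj] at hsum
  simpa using Complex.zero_le_real.1 hsum

/-- The functional `x ↦ ∑ ⟪b i, φ (x i j) (b j)⟫` on finitely supported matrices over `S`. -/
noncomputable def matrixFunctional (φ : UCPMap S H) (b : ι → H) :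
    (ι × ι →₀ S.toSubmodule) →ₗ[ℂ] ℂ :=
  Finsupp.lsum ℂ fun p ↦ (innerSL ℂ (b p.1)).toLinearMap ∘ₗ
    (ContinuousLinearMap.apply ℂ H (b p.2)).toLinearMap ∘ₗ φ.toLinearMap

lemma matrixFunctional_apply (φ : UCPMap S H) (b : ι → H) (x : ι × ι →₀ S.toSubmodule) :
    φ.matrixFunctional b x = x.sum fun p s ↦ ⟪b p.1, φ s (b p.2)⟫_ℂ := rfl

lemma re_matrixFunctional_nonneg (φ : UCPMap S H) (b : ι → H) {x : ι × ι →₀ S.toSubmodule}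
    (hx : Finsupp.mapRange.linearMap S.toSubmodule.subtype x ∈ accretiveCone ι A) :
    0 ≤ (φ.matrixFunctional b x).re := by
  classical
  let F : Finset ι := x.support.image Prod.fst ∪ x.support.image Prod.snd
  have hF : x.support ⊆ F ×ˢ F := fun p hp ↦ Finset.mem_product.2
    ⟨Finset.mem_union_left _ (Finset.mem_image_of_mem _ hp),
      Finset.mem_union_right _ (Finset.mem_image_of_mem _ hp)⟩
  have hsum := φ.re_sum_inner_nonneg (fun i : F ↦ b i) (M := Matrix.of fun i j ↦ x (i, j))
    ((mem_accretiveCone.1 hx).submatrix (Subtype.val : F → ι))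
  rw [matrixFunctional_apply, x.sum_of_support_subset hF _ (by simp), Finset.sum_product,
    ← Finset.sum_coe_sort F]
  simpa only [← Finset.sum_coe_sort F, Matrix.of_apply] using hsum

theorem exists_functional_extension (φ : UCPMap S H) (b : ι → H) :
    ∃ G : (ι × ι →₀ A) →ₗ[ℂ] ℂ,
      (∀ i j (x : S.toSubmodule), G (.single (i, j) x) = ⟪b i, φ x (b j)⟫_ℂ) ∧
      ∀ x ∈ accretiveCone ι A, 0 ≤ (G x).re := by
  obtain ⟨G, hGφ, hG⟩ := exists_linearMap_extension_re_nonneg (accretiveCone ι A)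
    (Finsupp.mapRange_injective _ (_root_.map_zero S.toSubmodule.subtype)
      S.toSubmodule.subtype_injective : Function.Injective
        (Finsupp.mapRange.linearMap S.toSubmodule.subtype)) (φ.matrixFunctional b)
    (fun _ ↦ φ.re_matrixFunctional_nonneg b) (exists_mapRange_add_mem_accretiveCone S)
  refine ⟨G, fun i j x ↦ ?_, hG⟩
  simpa [matrixFunctional_apply] using hGφ (.single (i, j) x)

end UCPMap

lemma exists_linearIsometry_eq_of_inner_map_map {𝕜 E F : Type*} [RCLike 𝕜] [NormedAddCommGroup E]
    [InnerProductSpace 𝕜 E] [NormedAddCommGroup F] [InnerProductSpace 𝕜 F] {f : E → F}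
    (hf : ∀ x y, ⟪f x, f y⟫_𝕜 = ⟪x, y⟫_𝕜) : ∃ V : E →ₗᵢ[𝕜] F, ⇑V = f := by
  refine ⟨LinearMap.isometryOfInner ⟨⟨f, fun x y ↦ ?_⟩, fun r x ↦ ?_⟩ hf, rfl⟩
  · rw [← sub_eq_zero, ← inner_self_eq_zero (𝕜 := 𝕜)]
    simp only [inner_sub_left, inner_sub_right, inner_add_left, inner_add_right, hf]
    ring
  · rw [← sub_eq_zero, ← inner_self_eq_zero (𝕜 := 𝕜)]
    simp only [inner_sub_left, inner_sub_right, inner_smul_left, inner_smul_right, hf,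
      RingHom.id_apply]
    ring

section StarAction

open UniformSpace

variable {A : Type*} [CStarAlgebra A] {X : Type*} [SeminormedAddCommGroup X]
  [InnerProductSpace ℂ X] {m : A →ₐ[ℂ] Module.End ℂ X}

/-- An action of a C⋆-algebra by operators on a pre-Hilbert space that turns the involution
into (formal) adjoints. Boundedness is a consequence. -/
def IsStarAction (m : A →ₐ[ℂ] Module.End ℂ X) : Prop :=
  ∀ a x y, ⟪m (star a) x, y⟫_ℂ = ⟪x, m a y⟫_ℂ

namespace IsStarAction

lemma re_inner_star_mul_self (hm : IsStarAction m) (a : A) (x : X) :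
    (⟪x, m (star a * a) x⟫_ℂ).re = ‖m a x‖ ^ 2 := by
  rw [map_mul, Module.End.mul_apply, ← hm (star a), star_star]
  exact inner_self_eq_norm_sq (𝕜 := ℂ) _

lemma norm_le (hm : IsStarAction m) (a : A) (x : X) : ‖m a x‖ ≤ ‖a‖ * ‖x‖ := by
  let _ := CStarAlgebra.spectralOrder A
  let _ := CStarAlgebra.spectralOrderedRing A
  obtain ⟨d, hd⟩ := CStarAlgebra.nonneg_iff_eq_star_mul_self.1
    (sub_nonneg.2 (IsSelfAdjoint.star_mul_self a).le_algebraMap_norm_self)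
  have hnonneg : 0 ≤ (⟪x, m (algebraMap ℝ A ‖star a * a‖ - star a * a) x⟫_ℂ).re := by
    rw [hd, hm.re_inner_star_mul_self]
    positivity
  have hscalar : m (algebraMap ℝ A ‖star a * a‖) = ((‖a‖ ^ 2 : ℝ) : ℂ) • 1 := by
    rw [CStarRing.norm_star_mul_self, ← sq, Algebra.algebraMap_eq_smul_one, ← Complex.coe_smul,
      map_smul, map_one]
  rw [map_sub, LinearMap.sub_apply, inner_sub_right, Complex.sub_re, sub_nonneg,
    hm.re_inner_star_mul_self, hscalar, LinearMap.smul_apply, Module.End.one_apply,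
    inner_smul_right, Complex.re_ofReal_mul] at hnonneg
  rw [← sq_le_sq₀ (by positivity) (by positivity), mul_pow]
  exact hnonneg.trans_eq (congrArg _ (inner_self_eq_norm_sq (𝕜 := ℂ) x))

/-- The continuous extension of `m a` to the completion. -/
noncomputable def extend (hm : IsStarAction m) (a : A) : Completion X →L[ℂ] Completion X :=
  ((m a).mkContinuous ‖a‖ (hm.norm_le a)).completion

@[simp]
lemma extend_coe (hm : IsStarAction m) (a : A) (x : X) : hm.extend a x = (m a x : X) :=
  ContinuousLinearMap.completion_apply_coe _ x

lemma extend_eq_iff (hm : IsStarAction m) {a : A} {T : Completion X →L[ℂ] Completion X} :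
    hm.extend a = T ↔ ∀ x : X, ((m a x : X) : Completion X) = T x := by
  refine ⟨fun h x ↦ by rw [← h, extend_coe], fun h ↦ ?_⟩
  ext x
  induction x using Completion.induction_on with
  | hp => exact isClosed_eq (map_continuous _) (map_continuous _)
  | ih x => rw [extend_coe, h]

/-- The representation of `A` on the completion of `X` that extends the action `m`. -/
noncomputable def toStarAlgHom (hm : IsStarAction m) :
    A →⋆ₐ[ℂ] (Completion X →L[ℂ] Completion X) where
  toFun := hm.extend
  map_one' := hm.extend_eq_iff.2 fun x ↦ by simp
  map_mul' a b := hm.extend_eq_iff.2 fun x ↦ by simp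
  map_zero' := hm.extend_eq_iff.2 fun x ↦ by simp [Completion.coe_zero]
  map_add' a b := hm.extend_eq_iff.2 fun x ↦ by simp [Completion.coe_add]
  commutes' r := hm.extend_eq_iff.2 fun x ↦ by simp [Algebra.algebraMap_eq_smul_one]
  map_star' a := by
    rw [ContinuousLinearMap.star_eq_adjoint, ContinuousLinearMap.eq_adjoint_iff]
    intro x y
    induction x, y using Completion.induction_on₂ with
    | hp => apply isClosed_eq <;> fun_prop
    | ih x y => simp [hm a x y]

@[simp]
lemma toStarAlgHom_apply_coe (hm : IsStarAction m) (a : A) (x : X) :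
    hm.toStarAlgHom a (x : Completion X) = (m a x : X) :=
  hm.extend_coe a x

end IsStarAction

end StarAction

namespace UCPMap

variable {A : Type u} [CStarAlgebra A] [PartialOrder A] [StarOrderedRing A]
  {S : OperatorSystem A} {H : Type v} [NormedAddCommGroup H] [InnerProductSpace ℂ H]
  [CompleteSpace H]

theorem exists_starAlgHom_inner_eq {ι : Type w} (φ : UCPMap S H) (b : ι → H) :
    ∃ (K : Type max u w) (_ : NormedAddCommGroup K) (_ : InnerProductSpace ℂ K)
      (_ : CompleteSpace K) (ξ : ι → K) (π : A →⋆ₐ[ℂ] (K →L[ℂ] K)),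
      ∀ (x : S.toSubmodule) i j, ⟪ξ i, π x (ξ j)⟫_ℂ = ⟪b i, φ x (b j)⟫_ℂ := by
  obtain ⟨G, hGφ, hG⟩ := φ.exists_functional_extension b
  let _ : SeminormedAddCommGroup (ι →₀ A) :=
    InnerProductSpace.Core.toSeminormedAddCommGroup (c := accretiveCore G hG)
  let _ : InnerProductSpace ℂ (ι →₀ A) := InnerProductSpace.ofCore (accretiveCore G hG)
  have hinner (f g : ι →₀ A) : ⟪f, g⟫_ℂ = G (finsuppStarMul f g) := rfl
  have haction : IsStarAction (Algebra.lsmul (A := A) ℂ ℂ (ι →₀ A)) := fun a f g ↦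
    congrArg G (finsuppStarMul_star_smul a f g)
  refine ⟨UniformSpace.Completion (ι →₀ A), inferInstance, inferInstance, inferInstance,
    fun i ↦ (Finsupp.single i (1 : A) : ι →₀ A), haction.toStarAlgHom, fun x i j ↦ ?_⟩
  rw [haction.toStarAlgHom_apply_coe, UniformSpace.Completion.inner_coe, hinner]
  simpa [finsuppStarMul_single_single] using hGφ i j x

theorem exists_isDilation_ofStarAlgHom (φ : UCPMap S H) :
    ∃ (K : Type max u v w) (_ : NormedAddCommGroup K) (_ : InnerProductSpace ℂ K)
      (_ : CompleteSpace K) (V : H →ₗᵢ[ℂ] K) (π : A →⋆ₐ[ℂ] (K →L[ℂ] K)),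
      φ.IsDilation V (ofStarAlgHom π) := by
  obtain ⟨K, _, _, _, ξ, π, hξ⟩ := φ.exists_starAlgHom_inner_eq (ULift.down : ULift.{w} H → H)
  obtain ⟨V, hV⟩ := exists_linearIsometry_eq_of_inner_map_map (𝕜 := ℂ)
    (f := fun h : H ↦ ξ ⟨h⟩) fun h k ↦ by simpa [φ.apply_one] using hξ 1 ⟨h⟩ ⟨k⟩
  exact ⟨K, _, _, _, V, π, isDilation_iff.2 fun x h k ↦ by simpa [hV] using hξ x ⟨h⟩ ⟨k⟩⟩

end UCPMap

section Representations

variable {A : Type*} [CStarAlgebra A]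
  {H : Type*} [NormedAddCommGroup H] [InnerProductSpace ℂ H] [CompleteSpace H]
  {K : Type*} [NormedAddCommGroup K] [InnerProductSpace ℂ K] [CompleteSpace K]
  {π : A →⋆ₐ[ℂ] (K →L[ℂ] K)} {V : H →ₗᵢ[ℂ] K}

/-- The elements `a` of `A` for which the subspace `N` is invariant under `π a` and `π (star a)`. -/
def reducingSubalgebra (π : A →⋆ₐ[ℂ] (K →L[ℂ] K)) (N : Submodule ℂ K) : StarSubalgebra ℂ A where
  carrier := {a | ∀ k ∈ N, π a k ∈ N ∧ π (star a) k ∈ N}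
  mul_mem' {a b} ha hb k hk := by
    rw [star_mul, map_mul, map_mul]
    exact ⟨(ha _ (hb k hk).1).1, (hb _ (ha k hk).2).2⟩
  add_mem' {a b} ha hb k hk := by
    rw [star_add, map_add, map_add]
    exact ⟨N.add_mem (ha k hk).1 (hb k hk).1, N.add_mem (ha k hk).2 (hb k hk).2⟩
  algebraMap_mem' r k hk := by
    rw [← algebraMap_star_comm, AlgHomClass.commutes, AlgHomClass.commutes]
    exact ⟨N.smul_mem _ hk, N.smul_mem _ hk⟩
  star_mem' {a} ha k hk := by
    rw [star_star]
    exact (ha k hk).symm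

lemma isClosed_reducingSubalgebra {N : Submodule ℂ K} (hN : IsClosed (N : Set K)) :
    IsClosed (reducingSubalgebra π N : Set A) := by
  have hcont (k : K) : Continuous fun a ↦ π a k := (map_continuous π).clm_apply continuous_const
  have hset : (reducingSubalgebra π N : Set A) =
      ⋂ k ∈ N, {a | π a k ∈ N} ∩ {a | π (star a) k ∈ N} := by
    ext a
    simp [reducingSubalgebra]
  rw [hset]
  exact isClosed_biInter fun k _ ↦
    (hN.preimage (hcont k)).inter (hN.preimage ((hcont k).comp continuous_star))

lemma OperatorSystem.map_mem_of_isClosed (S : OperatorSystem A) {N : Submodule ℂ K}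
    (hN : IsClosed (N : Set K)) (h : ∀ x ∈ S.toSubmodule, ∀ k ∈ N, π x k ∈ N) (a : A) :
    ∀ k ∈ N, π a k ∈ N := fun k hk ↦ by
  have htop := S.eq_top_of_isClosed (isClosed_reducingSubalgebra (π := π) hN)
    fun x hx k hk ↦ ⟨h x hx k hk, h _ (S.star_mem x hx) k hk⟩
  exact (htop.ge (StarSubalgebra.mem_top (x := a)) k hk).1

lemma map_compress_of_mem_range {T : K →L[ℂ] K} {h : H}
    (hT : T (V h) ∈ LinearMap.range V.toLinearMap) :
    V (compress V.toContinuousLinearMap T h) = T (V h) := by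
  obtain ⟨g, hg : V g = T (V h)⟩ := hT
  rw [← hg]
  refine congrArg V (ext_inner_left ℂ fun k ↦ ?_)
  rw [inner_compress_apply, V.coe_toContinuousLinearMap, ← hg, V.inner_map_map]

/-- The representation on `H` obtained by restricting `π` to the reducing subspace `V(H)`. -/
noncomputable def compressStarAlgHom (π : A →⋆ₐ[ℂ] (K →L[ℂ] K)) (V : H →ₗᵢ[ℂ] K)
    (hV : ∀ a h, π a (V h) ∈ LinearMap.range V.toLinearMap) : A →⋆ₐ[ℂ] (H →L[ℂ] H) where
  toFun a := compress V.toContinuousLinearMap (π a)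
  map_one' := by rw [map_one, compress_one]
  map_mul' a b := compress_eq_iff.2 fun h k ↦ by
    rw [mul_apply_eq_comp, inner_compress_apply, V.coe_toContinuousLinearMap,
      map_compress_of_mem_range (hV b k), map_mul, mul_apply_eq_comp]
  map_zero' := by rw [map_zero, map_zero]
  map_add' a b := by rw [map_add, map_add]
  commutes' r := by
    rw [AlgHomClass.commutes, Algebra.algebraMap_eq_smul_one, map_smul, compress_one,
      ← Algebra.algebraMap_eq_smul_one]
  map_star' a := by rw [map_star, star_compress]

lemma starAlgHom_apply_map_of_compress_eq {ρ : A →⋆ₐ[ℂ] (H →L[ℂ] H)}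
    (h : ∀ a, compress V.toContinuousLinearMap (π a) = ρ a) (a : A) (k : H) :
    π a (V k) = V (ρ a k) := by
  have hinner (a : A) (g k : H) : ⟪V g, π a (V k)⟫_ℂ = ⟪g, ρ a k⟫_ℂ :=
    compress_eq_iff.1 (h a) g k
  have hsq : ⟪π a (V k), π a (V k)⟫_ℂ = ⟪ρ a k, ρ a k⟫_ℂ := by
    simpa only [map_mul, map_star, mul_apply_eq_comp, ContinuousLinearMap.star_eq_adjoint,
      ContinuousLinearMap.adjoint_inner_right] using hinner (star a * a) k k
  have hcross : ⟪π a (V k), V (ρ a k)⟫_ℂ = ⟪ρ a k, ρ a k⟫_ℂ := by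
    rw [← inner_conj_symm, hinner, inner_conj_symm]
  rw [← sub_eq_zero, ← inner_self_eq_zero (𝕜 := ℂ)]
  simp only [inner_sub_left, inner_sub_right, hinner, hsq, hcross, V.inner_map_map, sub_self]

end Representations

namespace UCPMap

section

variable {A : Type*} [CStarAlgebra A] [PartialOrder A] [StarOrderedRing A] {S : OperatorSystem A}
  {H : Type*} [NormedAddCommGroup H] [InnerProductSpace ℂ H] [CompleteSpace H]
  {K : Type*} [NormedAddCommGroup K] [InnerProductSpace ℂ K] [CompleteSpace K]
  {φ : UCPMap S H} {V : H →ₗᵢ[ℂ] K} {φ' : UCPMap S K}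

lemma IsExtension.apply_one {Φ : A →CP (H →L[ℂ] H)} (h : φ.IsExtension Φ) : Φ 1 = 1 :=
  (h 1).trans φ.apply_one

lemma IsDirectSum.apply_map {ψ : UCPMap S ((LinearMap.range V.toLinearMap)ᗮ : Submodule ℂ K)}
    (h : IsDirectSum V φ' φ ψ) (x : S.toSubmodule) (k : H) : φ' x (V k) = V (φ x k) := by
  simpa using h x k 0

lemma apply_mem_orthogonal_range (hV : ∀ x h, φ' x (V h) = V (φ x h)) (x : S.toSubmodule) {k : K}
    (hk : k ∈ (LinearMap.range V.toLinearMap)ᗮ) :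
    φ' x k ∈ (LinearMap.range V.toLinearMap)ᗮ := by
  rintro _ ⟨g, rfl⟩
  have hstar : ⟪φ' (star x) (V g), k⟫_ℂ = 0 := by
    rw [hV]
    exact Submodule.inner_right_of_mem_orthogonal (LinearMap.mem_range_self V.toLinearMap _) hk
  rwa [φ'.map_star, ContinuousLinearMap.star_eq_adjoint,
    ContinuousLinearMap.adjoint_inner_left] at hstar

lemma exists_isDirectSum (hV : ∀ x h, φ' x (V h) = V (φ x h)) :
    ∃ ψ : UCPMap S ((LinearMap.range V.toLinearMap)ᗮ : Submodule ℂ K), IsDirectSum V φ' φ ψ := by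
  let N : Submodule ℂ K := (LinearMap.range V.toLinearMap)ᗮ
  refine ⟨φ'.compression N.subtypeₗᵢ, fun x h k ↦ ?_⟩
  have hψ : ((φ'.compression N.subtypeₗᵢ x k : N) : K) = φ' x k :=
    map_compress_of_mem_range (V := N.subtypeₗᵢ) ⟨⟨_, apply_mem_orthogonal_range hV x k.2⟩, rfl⟩
  rw [map_add, hV, hψ]

lemma IsDilation.isExtension_compressCP (hV : φ.IsDilation V φ') {Φ : A →CP (K →L[ℂ] K)}
    (hΦ : φ'.IsExtension Φ) : φ.IsExtension (compressCP Φ V.toContinuousLinearMap) := fun x ↦ by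
  rw [compressCP_apply, hΦ x]
  exact hV x

lemma isExtension_ofStarAlgHom (π : A →⋆ₐ[ℂ] (H →L[ℂ] H)) :
    (ofStarAlgHom π : UCPMap S H).IsExtension (π : A →CP (H →L[ℂ] H)) := fun _ ↦ rfl

lemma IsDilation.trans {L : Type*} [NormedAddCommGroup L] [InnerProductSpace ℂ L] [CompleteSpace L]
    {W : K →ₗᵢ[ℂ] L} {φ'' : UCPMap S L} (hV : φ.IsDilation V φ') (hW : φ'.IsDilation W φ'') :
    φ.IsDilation (W.comp V) φ'' :=
  isDilation_iff.2 fun x h k ↦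
    (isDilation_iff.1 hW x (V h) (V k)).trans (isDilation_iff.1 hV x h k)

lemma IsDilation.apply_map_of_apply_map_comp {L : Type*} [NormedAddCommGroup L]
    [InnerProductSpace ℂ L] [CompleteSpace L] {W : K →ₗᵢ[ℂ] L} {φ'' : UCPMap S L}
    (hW : φ'.IsDilation W φ'')
    {x : S.toSubmodule} {h : H} (hx : φ'' x (W (V h)) = W (V (φ x h))) :
    φ' x (V h) = V (φ x h) := by
  refine ext_inner_left ℂ fun k ↦ ?_
  rw [← isDilation_iff.1 hW, hx, W.inner_map_map]

lemma HasUniqueExtensionProperty.apply_map_of_isDilation_ofStarAlgHom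
    (hφ : φ.HasUniqueExtensionProperty) {π : A →⋆ₐ[ℂ] (K →L[ℂ] K)}
    (hV : φ.IsDilation V (ofStarAlgHom π)) (x : S.toSubmodule) (h : H) :
    π x (V h) = V (φ x h) := by
  obtain ⟨Φ, hΦ, hunique, ρ, hρ⟩ := hφ
  have hcompress := hunique _ (hV.isExtension_compressCP (isExtension_ofStarAlgHom π))
  rw [← hΦ x, ← hρ]
  refine starAlgHom_apply_map_of_compress_eq (fun a ↦ ?_) (x : A) h
  rw [hρ, ← hcompress]
  rfl

end

variable {A : Type u} [CStarAlgebra A] [PartialOrder A] [StarOrderedRing A]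
  {S : OperatorSystem A} {H : Type v} [NormedAddCommGroup H] [InnerProductSpace ℂ H]
  [CompleteSpace H] {φ : UCPMap S H}

theorem HasUniqueExtensionProperty.isMaximal (hφ : φ.HasUniqueExtensionProperty) :
    IsMaximal.{u, v, w} φ := by
  intro K _ _ _ V φ' hV
  obtain ⟨L, _, _, _, W, π, hW⟩ := exists_isDilation_ofStarAlgHom.{u, w, w} φ'
  exact exists_isDirectSum fun x h ↦ hW.apply_map_of_apply_map_comp
    (hφ.apply_map_of_isDilation_ofStarAlgHom (hV.trans hW) x h)

theorem exists_isExtension (φ : UCPMap S H) : ∃ Φ : A →CP (H →L[ℂ] H), φ.IsExtension Φ := by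
  obtain ⟨K, _, _, _, V, π, hV⟩ := exists_isDilation_ofStarAlgHom.{u, v, u} φ
  exact ⟨_, hV.isExtension_compressCP (isExtension_ofStarAlgHom π)⟩

lemma IsMaximal.exists_starAlgHom_eq (hφ : IsMaximal.{u, v, max u v w} φ)
    {Φ : A →CP (H →L[ℂ] H)} (hΦ : φ.IsExtension Φ) :
    ∃ ρ : A →⋆ₐ[ℂ] (H →L[ℂ] H), ∀ a, ρ a = Φ a := by
  obtain ⟨K, _, _, _, V, π, hπ⟩ := exists_isDilation_ofStarAlgHom.{u, v, w}
    (ofCompletelyPositiveMap Φ hΦ.apply_one : UCPMap (OperatorSystem.top A) H)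
  have hcompress (a : A) : compress V.toContinuousLinearMap (π a) = Φ a := hπ ⟨a, trivial⟩
  obtain ⟨ψ, hψ⟩ := hφ K V (ofStarAlgHom π) fun x ↦ (hcompress x).trans (hΦ x)
  have hrange := S.map_mem_of_isClosed (π := π) (N := LinearMap.range V.toLinearMap)
    V.isometry.isClosedEmbedding.isClosed_range (by
      rintro x hx _ ⟨h, rfl⟩
      exact ⟨φ ⟨x, hx⟩ h, (hψ.apply_map ⟨x, hx⟩ h).symm⟩)
  exact ⟨compressStarAlgHom π V fun a h ↦ hrange a _ ⟨h, rfl⟩, hcompress⟩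

theorem IsMaximal.hasUniqueExtensionProperty (hφ : IsMaximal.{u, v, max u v w} φ) :
    φ.HasUniqueExtensionProperty := by
  obtain ⟨Φ, hΦ⟩ := φ.exists_isExtension
  obtain ⟨π, hπ⟩ := IsMaximal.exists_starAlgHom_eq.{u, v, w} hφ hΦ
  refine ⟨Φ, hΦ, fun Ψ hΨ ↦ ?_, π, hπ⟩
  obtain ⟨ρ, hρ⟩ := IsMaximal.exists_starAlgHom_eq.{u, v, w} hφ hΨ
  have hρπ : ρ = π := S.starAlgHom_ext fun x hx ↦ by
    rw [hρ, hπ, hΨ ⟨x, hx⟩, hΦ ⟨x, hx⟩]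
  exact DFunLike.ext _ _ fun a ↦ by rw [← hρ, hρπ, hπ]

end UCPMap

theorem proposition2p3 {A : Type u} [CStarAlgebra A] [PartialOrder A]
    [StarOrderedRing A] (S : OperatorSystem A) {H : Type v} [NormedAddCommGroup H]
    [InnerProductSpace ℂ H] [CompleteSpace H] (φ : UCPMap S H) :
    φ.HasUniqueExtensionProperty ↔ UCPMap.IsMaximal.{u, v, max u v w} φ :=
  ⟨fun h => h.isMaximal, fun h => UCPMap.IsMaximal.hasUniqueExtensionProperty.{u, v, w} h⟩
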